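/- **Conventions.** Let $B$ be a unital $C^*$-algebra and $\operatorname{Re}B$ its set of self-adjoint elements. An *isocone* of $B$ is a norm-closed subset $I\subset\operatorname{Re}B$ that contains the real multiples of $1$, is stable under addition, satisfies $f(a)\in I$ for all $a\in I$ and all continuous nondecreasing $f:\mathbb R\to\mathbb R$ (functional calculus), and is such that $\overline{I-I}=\operatorname{Re}B$. For functionals $\varphi,\psi$ that are states of $B$, write $\varphi\le_I\psi$ if $\varphi(a)\le\psi(a)$ for all $a\in I$. Let $M$ be a compact Hausdorff space, $n_1,\dots,n_K\ge 1$ integers, $A_f=\bigoplus_{k=1}^K M_{n_k}(\mathbb C)$ and $A=\mathcal C(M)\otimes A_f\cong\mathcal C(M,A_f)$; write $F_k(x)\in M_{n_k}(\mathbb C)$ for the $k$-th component of $F(x)$, for $F\in A$ and $x\in M$. The pure states of $A$ are denoted $(k,x,\xi)$ with $1\le k\le K$, $x\in M$, $\xi\in\mathbb{CP}^{n_k-1}$; the state $(k,x,\xi)$ is $F\mapsto\xi^\dagger F_k(x)\,\xi$, with $\xi$ represented by a unit vector. Likewise the pure states of $M_n(\mathbb C)$ are $a\mapsto\xi^\dagger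 a\,\xi$, $\xi\in\mathbb{CP}^{n-1}$. Put $M_K=\{1,\dots,K\}\times M$ (with $\{1,\dots,K\}$ discrete). The spectrum is denoted $\sigma$. For a partial order $\preceq$, $p\prec q$ means $p\preceq q$ and $p\ne q$. **Theorem.** Let $I$ be an isocone of $A$, and for $(k,x)\in M_K$ let $I_{k,x}$ be the closure of $\{F_k(x)\mid F\in I\}$ in $M_{n_k}(\mathbb C)$. Then each $I_{k,x}$ is an isocone of $M_{n_k}(\mathbb C)$, $\le_I$ is a partial order on the set of pure states $(k,x,\xi)$ of $A$, and there is a partial order $\preceq$ on $M_K$, closed in $M_K\times M_K$, such that: 1. for all pure states $(k,x,\xi)$ and $(l,y,\eta)$ of $A$, $$(k,x,\xi)\le_I(l,y,\eta)\iff (k,x)\prec(l,y)\ \text{ or }\ \bigl((k,x)=(l,y)\text{ and }\xi\le_{I_{k,x}}\eta\bigr);$$ 2. for all $k,l$ with $(n_k,n_l)\neq(1,1)$ and all $x,y\in M$, $$(k,x)\prec(l,y)\iff \forall F\in I:\ \max\sigma(F_k(x))\le\min\sigma(F_l(y));$$ 3. for all $k,l$ with $(n_k,n_l)\neq(1,1)$,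 the graph $\mathcal G_{k,l}=\{(x,y)\in M\times M\mid (k,x)\prec(l,y)\}$ is closed in $M\times M$. -/

import Mathlib

open scoped Matrix.Norms.L2Operator

noncomputable section

/-- An isocone of a unital C⋆-algebra `A`: a norm-closed set of self-adjoint elements which
contains the real constants, is stable under sums and under the continuous functional calculus by
continuous nondecreasing functions `ℝ → ℝ`, and whose differences are dense in the self-adjoint
part of `A`. -/
structure IsIsocone {A : Type*} [CStarAlgebra A] (I : Set A) : Prop where
  isSelfAdjoint : ∀ a ∈ I, IsSelfAdjoint a
  const_mem : ∀ r : ℝ, algebraMap ℝ A r ∈ I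
  add_mem : ∀ a ∈ I, ∀ b ∈ I, a + b ∈ I
  cfc_mem : ∀ a ∈ I, ∀ f : ℝ → ℝ, Continuous f → Monotone f → cfc f a ∈ I
  isClosed : IsClosed I
  closure_sub : closure {c : A | ∃ a ∈ I, ∃ b ∈ I, c = a - b} = {a : A | IsSelfAdjoint a}

/-- The relation `φ ≤_I ψ` between functionals: `φ(a) ≤ ψ(a)` for all `a ∈ I`. It is used for
states and for sets `I` of self-adjoint elements, on which states take real values. -/
def FunctionalLE {A : Type*} [AddCommGroup A] [Module ℂ A] (I : Set A) (φ ψ : A →ₗ[ℂ] ℂ) : Prop :=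
  ∀ a ∈ I, (φ a).re ≤ (ψ a).re

/-- The projective space `ℂP^{m-1}` of lines in `ℂ^m` (the pure states of `M_m(ℂ)`). -/
abbrev Ray (m : ℕ) : Type := Projectivization ℂ (EuclideanSpace ℂ (Fin m))

/-- The pure state `a ↦ ξ† a ξ` of `M_m(ℂ)` attached to a line `ξ` in `ℂ^m`, computed on a
normalized representative of the line. -/
def Ray.state {m : ℕ} (ξ : Ray m) : Matrix (Fin m) (Fin m) ℂ →ₗ[ℂ] ℂ where
  toFun a := inner ℂ (((‖ξ.rep‖⁻¹ : ℝ) : ℂ) • ξ.rep)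
    (Matrix.toEuclideanLin a (((‖ξ.rep‖⁻¹ : ℝ) : ℂ) • ξ.rep))
  map_add' a b := by simp only [map_add, LinearMap.add_apply, inner_add_right]
  map_smul' c a := by
    rw [map_smul Matrix.toEuclideanLin c a, LinearMap.smul_apply, inner_smul_right, smul_eq_mul,
      RingHom.id_apply]

/-- The value does not depend on the chosen unit vector of the line. -/
theorem Ray.state_mk {m : ℕ} (v : EuclideanSpace ℂ (Fin m)) (hv : v ≠ 0) (h1 : ‖v‖ = 1)
    (a : Matrix (Fin m) (Fin m) ℂ) :
    Ray.state (Projectivization.mk ℂ v hv) a = inner ℂ v (Matrix.toEuclideanLin a v) := by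
  obtain ⟨c, hc⟩ := Projectivization.exists_smul_eq_mk_rep ℂ v hv
  have hc0 : ‖(c : ℂ)‖ ≠ 0 := norm_ne_zero_iff.mpr c.ne_zero
  have hc' : (Projectivization.mk ℂ v hv).rep = (c : ℂ) • v := hc.symm
  have key : (starRingEnd ℂ) (c : ℂ) * (c : ℂ) = ((‖(c : ℂ)‖ : ℝ) : ℂ) ^ 2 := by
    rw [mul_comm, Complex.mul_conj, Complex.normSq_eq_norm_sq]; push_cast; rfl
  have hcc : ((‖(c : ℂ)‖ : ℝ) : ℂ) ≠ 0 := by exact_mod_cast hc0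
  simp only [Ray.state, LinearMap.coe_mk, AddHom.coe_mk, hc', norm_smul, h1, mul_one, map_smul,
    inner_smul_left, inner_smul_right, Complex.ofReal_inv, map_inv₀, Complex.conj_ofReal]
  generalize inner ℂ v (Matrix.toEuclideanLin a v) = z
  calc _ = ((‖(c : ℂ)‖ : ℝ) : ℂ)⁻¹ * ((‖(c : ℂ)‖ : ℝ) : ℂ)⁻¹ *
        ((starRingEnd ℂ) (c : ℂ) * (c : ℂ)) * z := by ring
    _ = z := by rw [key]; field_simp

/-- The almost-commutative C⋆-algebra `C(M) ⊗ ⨁ₖ M_{nₖ}(ℂ)`, realized as the continuous functions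
on `M` with values in `⨁ₖ M_{nₖ}(ℂ)` (each block with the operator norm, the sum with the
maximum norm); the component `Fₖ(x)` of `F` is `F x k`. -/
abbrev ACAlg (M : Type*) [TopologicalSpace M] {K : ℕ} (n : Fin K → ℕ) : Type _ :=
  C(M, (k : Fin K) → Matrix (Fin (n k)) (Fin (n k)) ℂ)

/-- The pure state space `P(A) = ∐ₖ M × ℂP^{nₖ-1}` of `A = C(M) ⊗ ⨁ₖ M_{nₖ}(ℂ)`, with elements
`⟨k, x, ξ⟩`. -/
abbrev ACPureState (M : Type*) {K : ℕ} (n : Fin K → ℕ) : Type _ :=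
  (k : Fin K) × M × Ray (n k)

/-- The functional `F ↦ ξ† Fₖ(x) ξ` on `A` given by `(k, x, ξ) ∈ P(A)`. -/
def ACPureState.state {M : Type*} [TopologicalSpace M] {K : ℕ} {n : Fin K → ℕ}
    (p : ACPureState M n) : ACAlg M n →ₗ[ℂ] ℂ where
  toFun F := p.2.2.state (F p.2.1 p.1)
  map_add' F G := by simp
  map_smul' c F := by simp

/-- The local set `I_{k,x}`, the closure of `πₖ(I(x)) = {Fₖ(x) | F ∈ I}` in `M_{nₖ}(ℂ)`. -/
def localCone {M : Type*} [TopologicalSpace M] {K : ℕ} {n : Fin K → ℕ}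
    (I : Set (ACAlg M n)) (k : Fin K) (x : M) : Set (Matrix (Fin (n k)) (Fin (n k)) ℂ) :=
  closure {a | ∃ F ∈ I, a = F x k}

/-- The lexicographic combination of a strict relation on the base `{1,…,K} × M` and of relations
on the fibres `ℂP^{nₖ-1}`: `(k,x,ξ)` is below `(l,y,η)` iff `(k,x)` is strictly below `(l,y)`, or
`(k,x) = (l,y)` and `ξ` is below `η` in this fibre. -/
inductive LexRel {M : Type*} {K : ℕ} {n : Fin K → ℕ} (lt : Fin K × M → Fin K × M → Prop)
    (fib : (k : Fin K) → M → Ray (n k) → Ray (n k) → Prop) :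
    ACPureState M n → ACPureState M n → Prop
  | base {k l : Fin K} {x y : M} {ξ : Ray (n k)} {η : Ray (n l)} (h : lt (k, x) (l, y)) :
      LexRel lt fib ⟨k, x, ξ⟩ ⟨l, y, η⟩
  | fibre {k : Fin K} {x : M} {ξ η : Ray (n k)} (h : fib k x ξ η) :
      LexRel lt fib ⟨k, x, ξ⟩ ⟨k, x, η⟩

/-- The strict part `p ≺ q` of an order: `p ≼ q` and `p ≠ q`. -/
def StrictPart {X : Type*} (le : X → X → Prop) (p q : X) : Prop := le p q ∧ p ≠ q

/-- Largest spectral value of a hermitian matrix of positive size. -/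
def maxSpec {m : ℕ} (a : Matrix (Fin m) (Fin m) ℂ) : ℝ := sSup (spectrum ℝ a)

/-- Smallest spectral value of a hermitian matrix of positive size. -/
def minSpec {m : ℕ} (a : Matrix (Fin m) (Fin m) ℂ) : ℝ := sInf (spectrum ℝ a)

end

/-!
Let `I` be an isocone of `A = C(M, ⨁ₖ M_{nₖ}(ℂ))`. Call a point `p` of the base `{1,…,K} × M` *fully
below* a point `q` if every pure state over `p` is `≤_I` every pure state over `q` (`FibreLE`). By
the variational characterization of extreme eigenvalues, this means that
`max σ(F(p)) ≤ min σ(F(q))` for all `F ∈ I`. The order on the base is "equal or fully below". Its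
closedness is clear, since it is cut out by inequalities between continuous functions, and its order
axioms follow from those of `≤_I` on pure states, which in turn hold because `I - I` is dense in the
self-adjoint elements and these separate the pure states. A point over a block of size at least two
is never fully below itself, because that block has several pure states.

What remains is that over distinct points `p ≠ q` one comparable pair of pure states `ξ`, `η` forces
`p` to be fully below `q`. Evaluation at `p` and `q` maps `A` onto `M_m(ℂ) × M_k(ℂ)`, and the
closure of the image of `I` is an isocone `J` there (`IsIsocone.closure_image`). In finite dimension `J` is
the closure of its interior in the self-adjoint part (`IsIsocone.closure_interior`). If the claim
fails, there is thus an interior pair `(a, b)` of `J` such that `a` has an eigenvalue `r`, with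
eigenvector `v`, larger than an eigenvalue `s` of `b`, with eigenvector `w`. A small perturbation
`a'` of `a` has the eigenvector `v + t ξ` for `r` (`Matrix.exists_perturbation`), and `(a', b) ∈ J`.
Let `f` rise from `0` at `s` to `1` at `r`. The range of `f(a) + f(a')` contains `v` and `v + t ξ`,
hence `ξ`, so a second truncation `g`, equal to `1` on the positive eigenvalues, satisfies
`g(f(a) + f(a')) ξ = ξ`. As `(g(f(a) + f(a')), g(2 f(b)))` lies in `J`, the comparison of `ξ` and
`η` gives `⟨η, g(2 f(b)) η⟩ ≥ 1`, so that `g(2 f(b)) η = η`; but this matrix kills `w`, whence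
`w ⟂ η` (`IsIsocone.dotProduct_eq_zero`). The same argument for a perturbation of `b` with the
eigenvector `w + t η` gives `w + t η ⟂ η`, a contradiction (`IsIsocone.state_le_of_state_le`).
-/

/-! ### Isocones of C⋆-algebras -/

section Isocone

open Set Topology

variable {A B : Type*} [CStarAlgebra A] [CStarAlgebra B]

/-- The real functional calculus of a fixed continuous function is continuous on self-adjoint
elements. -/
theorem continuousOn_cfc_isSelfAdjoint {f : ℝ → ℝ} (hf : Continuous f) :
    ContinuousOn (fun a : A => cfc f a) {a | IsSelfAdjoint a} :=
  ContinuousOn.cfc_of_mem_nhdsSet (s := univ) f Filter.univ_mem continuousOn_id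
    (fun _ hx => hx) hf.continuousOn

theorem StarAlgHom.map_cfc_real (π : A →⋆ₐ[ℂ] B) (hπ : Continuous π) {f : ℝ → ℝ}
    (hf : Continuous f) {a : A} (ha : IsSelfAdjoint a) : π (cfc f a) = cfc f (π a) :=
  StarAlgHomClass.map_cfc π f a hf.continuousOn hπ ha (ha.map π)

theorem IsIsocone.smul_mem {I : Set A} (hI : IsIsocone I) {r : ℝ} (hr : 0 ≤ r) {a : A}
    (ha : a ∈ I) : r • a ∈ I := by
  have := hI.cfc_mem a ha (fun s => r * s) (by fun_prop) (fun s t h => by dsimp only; gcongr)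
  rwa [cfc_const_mul_id r a (hI.isSelfAdjoint a ha)] at this

/-- The closed image of an isocone under a continuous unital `⋆`-homomorphism that is onto the
self-adjoint elements is again an isocone. -/
theorem IsIsocone.closure_image {I : Set A} (hI : IsIsocone I) (π : A →⋆ₐ[ℂ] B)
    (hπ : Continuous π) (hsurj : ∀ b : B, IsSelfAdjoint b → ∃ a : A, IsSelfAdjoint a ∧ π a = b) :
    IsIsocone (closure (π '' I)) := by
  have hclosed : IsClosed {b : B | IsSelfAdjoint b} := isClosed_eq continuous_star continuous_id
  have hsa : closure (π '' I) ⊆ {b : B | IsSelfAdjoint b} := by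
    refine closure_minimal ?_ hclosed
    rintro _ ⟨a, ha, rfl⟩
    exact (hI.isSelfAdjoint a ha).map π
  refine ⟨fun a ha => hsa ha, fun r => ?_, fun a ha b hb => ?_, fun a ha f hf hmono => ?_,
    isClosed_closure, ?_⟩
  · refine subset_closure ⟨_, hI.const_mem r, ?_⟩
    rw [IsScalarTower.algebraMap_apply ℝ ℂ A, IsScalarTower.algebraMap_apply ℝ ℂ B]
    exact AlgHomClass.commutes π _
  · refine map_mem_closure₂ continuous_add ha hb ?_
    rintro _ ⟨c, hc, rfl⟩ _ ⟨d, hd, rfl⟩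
    exact ⟨c + d, hI.add_mem c hc d hd, map_add π c d⟩
  · have hcont : ContinuousWithinAt (fun b : B => cfc f b) (π '' I) a :=
      ((continuousOn_cfc_isSelfAdjoint hf) a (hsa ha)).mono (subset_closure.trans hsa)
    refine hcont.mem_closure ha ?_
    rintro _ ⟨c, hc, rfl⟩
    exact ⟨cfc f c, hI.cfc_mem c hc f hf hmono,
      π.map_cfc_real hπ hf (hI.isSelfAdjoint c hc)⟩
  · refine Subset.antisymm (closure_minimal ?_ hclosed) fun b hb => ?_
    · rintro _ ⟨a, ha, b, hb, rfl⟩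
      exact (hsa ha).sub (hsa hb)
    · obtain ⟨a, ha, rfl⟩ := hsurj b hb
      have ha' : a ∈ closure {c : A | ∃ a ∈ I, ∃ b ∈ I, c = a - b} := by
        rw [hI.closure_sub]; exact ha
      refine map_mem_closure hπ ha' ?_
      rintro _ ⟨c, hc, d, hd, rfl⟩
      exact ⟨π c, subset_closure ⟨c, hc, rfl⟩, π d, subset_closure ⟨d, hd, rfl⟩, map_sub π c d⟩

/-- An isocone separates continuous functionals: two functionals that dominate each other on it
have the same real part on all self-adjoint elements. -/
theorem IsIsocone.re_eq_of_functionalLE {I : Set A} (hI : IsIsocone I) {φ ψ : A →ₗ[ℂ] ℂ}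
    (hφ : Continuous φ) (hψ : Continuous ψ) (h₁ : FunctionalLE I φ ψ) (h₂ : FunctionalLE I ψ φ)
    {a : A} (ha : IsSelfAdjoint a) : (φ a).re = (ψ a).re := by
  have ha' : a ∈ closure {c : A | ∃ a ∈ I, ∃ b ∈ I, c = a - b} := by
    rw [hI.closure_sub]; exact ha
  have hcl : IsClosed {c : A | (φ c).re = (ψ c).re} :=
    isClosed_eq (Complex.continuous_re.comp hφ) (Complex.continuous_re.comp hψ)
  refine closure_minimal ?_ hcl ha'
  rintro _ ⟨c, hc, d, hd, rfl⟩
  have e₁ := le_antisymm (h₁ c hc) (h₂ c hc)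
  have e₂ := le_antisymm (h₁ d hd) (h₂ d hd)
  simp [map_sub, e₁, e₂]

theorem IsIsocone.cfc_prodMk_mem {J : Set (A × B)} (hJ : IsIsocone J) {a : A} {b : B}
    (h : (a, b) ∈ J) {f : ℝ → ℝ} (hf : Continuous f) (hmono : Monotone f) :
    (cfc f a, cfc f b) ∈ J := by
  have hsa := hJ.isSelfAdjoint _ h
  convert hJ.cfc_mem _ h f hf hmono using 1
  exact Prod.ext ((StarAlgHom.fst ℂ A B).map_cfc_real continuous_fst hf hsa).symm
    ((StarAlgHom.snd ℂ A B).map_cfc_real continuous_snd hf hsa).symm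

theorem FunctionalLE.closure {V : Type*} [AddCommGroup V] [Module ℂ V] [TopologicalSpace V]
    {S : Set V} {φ ψ : V →ₗ[ℂ] ℂ} (hφ : Continuous φ) (hψ : Continuous ψ)
    (h : FunctionalLE S φ ψ) : FunctionalLE (closure S) φ ψ := by
  have hcl : IsClosed {c : V | (φ c).re ≤ (ψ c).re} :=
    isClosed_le (Complex.continuous_re.comp hφ) (Complex.continuous_re.comp hψ)
  exact fun a ha => closure_minimal (fun c hc => h c hc) hcl ha

/-- In finite dimension the self-adjoint elements of an isocone form a convex set that is the
closure of its interior. -/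
theorem IsIsocone.closure_interior [FiniteDimensional ℂ A] {J : Set A} (hJ : IsIsocone J) :
    closure (interior {x : selfAdjoint.submodule ℝ A | (x : A) ∈ J}) =
      {x : selfAdjoint.submodule ℝ A | (x : A) ∈ J} := by
  have : FiniteDimensional ℝ A := FiniteDimensional.complexToReal A
  set C : Set (selfAdjoint.submodule ℝ A) := {x | (x : A) ∈ J} with hC
  have hconv : Convex ℝ C := fun x hx y hy s t hs ht _ =>
    hJ.add_mem _ (hJ.smul_mem hs hx) _ (hJ.smul_mem ht hy)
  have hcl : IsClosed C := hJ.isClosed.preimage continuous_subtype_val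
  have h0 : (0 : selfAdjoint.submodule ℝ A) ∈ C := by
    simpa [hC] using hJ.const_mem 0
  have hspan : affineSpan ℝ C = ⊤ := by
    rw [AffineSubspace.affineSpan_eq_top_iff_vectorSpan_eq_top_of_nonempty ℝ _ _ ⟨0, h0⟩,
      eq_top_iff]
    -- The span of the differences is dense, and closed because it is finite-dimensional.
    intro x _
    set W := (vectorSpan ℝ C).map (selfAdjoint.submodule ℝ A).subtype with hW
    have hWc : IsClosed (W : Set A) := W.closed_of_finiteDimensional
    have hx : (x : A) ∈ closure {c : A | ∃ a ∈ J, ∃ b ∈ J, c = a - b} := by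
      rw [hJ.closure_sub]; exact x.2
    have hxW : (x : A) ∈ W := by
      refine closure_minimal ?_ hWc hx
      rintro _ ⟨a, ha, b, hb, rfl⟩
      exact ⟨⟨a, hJ.isSelfAdjoint a ha⟩ - ⟨b, hJ.isSelfAdjoint b hb⟩,
        vsub_mem_vectorSpan ℝ (s := C) ha hb, rfl⟩
    obtain ⟨y, hy, hyx⟩ := hxW
    rwa [← Subtype.ext hyx]
  have hne : (interior C).Nonempty := by
    have := interior_convexHull_nonempty_iff_affineSpan_eq_top.mpr hspan
    rwa [hconv.convexHull_eq] at this
  rw [hconv.closure_interior_eq_closure_of_nonempty_interior hne, hcl.closure_eq]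

/-- In finite dimension, every element of an isocone can be approximated by elements around which
the isocone contains all self-adjoint elements. -/
theorem IsIsocone.exists_mem_nhdsWithin [FiniteDimensional ℂ A] {J : Set A} (hJ : IsIsocone J)
    {U : Set A} (hU : IsOpen U) {c : A} (hc : c ∈ J) (hcU : c ∈ U) :
    ∃ c' ∈ J, c' ∈ U ∧ J ∈ 𝓝[{a | IsSelfAdjoint a}] c' := by
  have hmem : (⟨c, hJ.isSelfAdjoint c hc⟩ : selfAdjoint.submodule ℝ A) ∈
      closure (interior {x : selfAdjoint.submodule ℝ A | (x : A) ∈ J}) := by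
    rw [hJ.closure_interior]; exact hc
  obtain ⟨x, hxU, hx⟩ :=
    mem_closure_iff.mp hmem _ (hU.preimage continuous_subtype_val) hcU
  exact ⟨x, interior_subset (s := {x : selfAdjoint.submodule ℝ A | (x : A) ∈ J}) hx, hxU,
    preimage_coe_mem_nhds_subtype.mp (mem_interior_iff_mem_nhds.mp hx)⟩

end Isocone

/-! ### Hermitian matrices and pure states of matrix algebras -/

section HermitianMatrix

open Matrix
open scoped MatrixOrder ComplexOrder

variable {m : ℕ}

theorem Matrix.algebraMap_real_mulVec (r : ℝ) (v : Fin m → ℂ) :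
    (algebraMap ℝ (Matrix (Fin m) (Fin m) ℂ) r) *ᵥ v = (r : ℂ) • v := by
  rw [Algebra.algebraMap_eq_smul_one, smul_mulVec, one_mulVec]
  rfl

theorem Matrix.exists_unit_smul {v : Fin m → ℂ} (hv : v ≠ 0) :
    ∃ c : ℂ, star (c • v) ⬝ᵥ (c • v) = 1 := by
  have h : ‖WithLp.toLp 2 v‖ ≠ 0 := by simpa using hv
  refine ⟨((‖WithLp.toLp 2 v‖⁻¹ : ℝ) : ℂ), ?_⟩
  have e : star v ⬝ᵥ v = ((‖WithLp.toLp 2 v‖ : ℝ) : ℂ) ^ 2 := by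
    have := inner_self_eq_norm_sq_to_K (𝕜 := ℂ) (WithLp.toLp 2 v)
    rw [EuclideanSpace.inner_eq_star_dotProduct, dotProduct_comm] at this
    exact this
  have h' : ((‖WithLp.toLp 2 v‖ : ℝ) : ℂ) ≠ 0 := by exact_mod_cast h
  rw [star_smul, smul_dotProduct, dotProduct_smul, e]
  simp only [Complex.ofReal_inv, star_inv₀, Complex.star_def, Complex.conj_ofReal, smul_eq_mul]
  field_simp

theorem Matrix.exists_unit_eigenvector {a : Matrix (Fin m) (Fin m) ℂ} {r : ℝ}
    (hr : r ∈ spectrum ℝ a) :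
    ∃ v : Fin m → ℂ, star v ⬝ᵥ v = 1 ∧ a *ᵥ v = (r : ℂ) • v := by
  rw [spectrum.mem_iff, Matrix.isUnit_iff_isUnit_det, isUnit_iff_ne_zero, not_not,
    ← exists_mulVec_eq_zero_iff] at hr
  obtain ⟨v, hv, h⟩ := hr
  rw [sub_mulVec, algebraMap_real_mulVec, sub_eq_zero] at h
  obtain ⟨c, hc⟩ := exists_unit_smul hv
  exact ⟨c • v, hc, by rw [mulVec_smul, ← h, smul_comm]⟩

/-- The functional calculus of a hermitian matrix acts on an eigenvector through the value at the
eigenvalue. No continuity is needed, the spectrum being finite. -/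
theorem Matrix.cfc_mulVec {a : Matrix (Fin m) (Fin m) ℂ} (ha : IsSelfAdjoint a) {r : ℝ}
    {v : Fin m → ℂ} (hv : a *ᵥ v = (r : ℂ) • v) (f : ℝ → ℝ) :
    cfc f a *ᵥ v = ((f r : ℝ) : ℂ) • v := by
  classical
  have hc (g : ℝ → ℝ) : ContinuousOn g (spectrum ℝ a) := a.finite_real_spectrum.continuousOn g
  set k : ℝ → ℝ := fun s => if s = r then 0 else (f s - f r) / (s - r) with hk
  have hf : f = fun s => f r + k s * (s - r) := by
    funext s
    by_cases h : s = r
    · simp [h]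
    · have : s - r ≠ 0 := sub_ne_zero.mpr h
      simp only [hk, h, if_false]
      field_simp
      ring
  have e : cfc f a = algebraMap ℝ _ (f r) + cfc k a * (a - algebraMap ℝ _ r) := by
    conv_lhs => rw [hf]
    rw [cfc_const_add (f r) (fun s => k s * (s - r)) a (hc _) ha,
      cfc_mul k (fun s => s - r) a (hc _) (hc _),
      cfc_sub (fun s => s) (fun _ => r) a (hc _) (hc _), cfc_id' ℝ a ha, cfc_const r a ha]
  rw [e, add_mulVec, ← mulVec_mulVec, sub_mulVec, hv, algebraMap_real_mulVec,
    algebraMap_real_mulVec, sub_self, mulVec_zero, add_zero]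

theorem Matrix.IsHermitian.dotProduct_mulVec_comm {a : Matrix (Fin m) (Fin m) ℂ}
    (ha : a.IsHermitian) (v w : Fin m → ℂ) : star v ⬝ᵥ a *ᵥ w = star (a *ᵥ v) ⬝ᵥ w := by
  rw [star_mulVec, ha.eq, dotProduct_mulVec]

theorem minSpec_le_of_mem {a : Matrix (Fin m) (Fin m) ℂ} {r : ℝ} (hr : r ∈ spectrum ℝ a) :
    minSpec a ≤ r := csInf_le a.finite_real_spectrum.bddBelow hr

theorem le_maxSpec_of_mem {a : Matrix (Fin m) (Fin m) ℂ} {r : ℝ} (hr : r ∈ spectrum ℝ a) :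
    r ≤ maxSpec a := le_csSup a.finite_real_spectrum.bddAbove hr

theorem spectrum_real_nonempty (hm : 1 ≤ m) {a : Matrix (Fin m) (Fin m) ℂ}
    (ha : IsSelfAdjoint a) : (spectrum ℝ a).Nonempty := by
  have : Nonempty (Fin m) := ⟨⟨0, hm⟩⟩
  exact ContinuousFunctionalCalculus.spectrum_nonempty a ha

theorem minSpec_mem (hm : 1 ≤ m) {a : Matrix (Fin m) (Fin m) ℂ} (ha : IsSelfAdjoint a) :
    minSpec a ∈ spectrum ℝ a :=
  (spectrum_real_nonempty hm ha).csInf_mem a.finite_real_spectrum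

theorem maxSpec_mem (hm : 1 ≤ m) {a : Matrix (Fin m) (Fin m) ℂ} (ha : IsSelfAdjoint a) :
    maxSpec a ∈ spectrum ℝ a :=
  (spectrum_real_nonempty hm ha).csSup_mem a.finite_real_spectrum

theorem Matrix.re_dotProduct_mulVec_mono {a b : Matrix (Fin m) (Fin m) ℂ} (h : a ≤ b)
    (u : Fin m → ℂ) : (star u ⬝ᵥ a *ᵥ u).re ≤ (star u ⬝ᵥ b *ᵥ u).re := by
  have := (Complex.le_def.mp ((Matrix.le_iff.mp h).dotProduct_mulVec_nonneg u)).1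
  rw [sub_mulVec, dotProduct_sub, Complex.sub_re, Complex.zero_re] at this
  linarith

theorem re_dotProduct_mulVec_le_maxSpec {a : Matrix (Fin m) (Fin m) ℂ} (ha : IsSelfAdjoint a)
    {u : Fin m → ℂ} (hu : star u ⬝ᵥ u = 1) : (star u ⬝ᵥ a *ᵥ u).re ≤ maxSpec a := by
  have h : a ≤ algebraMap ℝ _ (maxSpec a) :=
    (le_algebraMap_iff_spectrum_le ha).mpr fun x hx => le_maxSpec_of_mem hx
  have := re_dotProduct_mulVec_mono h u
  rwa [algebraMap_real_mulVec, dotProduct_smul, hu, smul_eq_mul, mul_one,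
    Complex.ofReal_re] at this

theorem minSpec_le_re_dotProduct_mulVec {a : Matrix (Fin m) (Fin m) ℂ} (ha : IsSelfAdjoint a)
    {u : Fin m → ℂ} (hu : star u ⬝ᵥ u = 1) : minSpec a ≤ (star u ⬝ᵥ a *ᵥ u).re := by
  have h : algebraMap ℝ _ (minSpec a) ≤ a :=
    (algebraMap_le_iff_le_spectrum ha).mpr fun x hx => minSpec_le_of_mem hx
  have := re_dotProduct_mulVec_mono h u
  rwa [algebraMap_real_mulVec, dotProduct_smul, hu, smul_eq_mul, mul_one,
    Complex.ofReal_re] at this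

/-- A unit eigenvector `v` of a hermitian matrix can be moved in any direction `x`, at the price
of a small hermitian perturbation of the matrix and with the same eigenvalue. -/
theorem Matrix.exists_perturbation {a : Matrix (Fin m) (Fin m) ℂ} (ha : IsSelfAdjoint a)
    {v : Fin m → ℂ} (hv1 : star v ⬝ᵥ v = 1) {r : ℝ} (hv : a *ᵥ v = (r : ℂ) • v)
    (x : Fin m → ℂ) :
    ∃ d : ℝ → Matrix (Fin m) (Fin m) ℂ, Continuous d ∧ d 0 = a ∧ (∀ t, IsSelfAdjoint (d t)) ∧
      ∀ t, d t *ᵥ (v + (t : ℂ) • x) = (r : ℂ) • (v + (t : ℂ) • x) := by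
  set z : ℝ → Fin m → ℂ := fun t => v + (t : ℂ) • x with hz
  -- `W t` is a multiple of the projection onto the orthogonal complement of `z t`.
  set W : ℝ → Matrix (Fin m) (Fin m) ℂ :=
    fun t => (star (z t) ⬝ᵥ z t) • 1 - vecMulVec (z t) (star (z t)) with hW
  set T : Matrix (Fin m) (Fin m) ℂ := a - algebraMap ℝ _ r with hT
  have hTsa : IsSelfAdjoint T := ha.sub (IsSelfAdjoint.algebraMap _ (.all r))
  have hTv : T *ᵥ v = 0 := by rw [hT, sub_mulVec, hv, algebraMap_real_mulVec, sub_self]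
  have hvT : star v ᵥ* T = 0 := by
    have := star_mulVec T v
    rw [hTv, star_zero] at this
    rw [this, ← star_eq_conjTranspose, hTsa.star_eq]
  have hzc : Continuous z := by fun_prop
  have hWsa (t : ℝ) : IsSelfAdjoint (W t) := by
    have h1 : star (star (z t) ⬝ᵥ z t) = star (z t) ⬝ᵥ z t :=
      (star_dotProduct (z t) (z t)).symm
    have h2 : star (vecMulVec (z t) (star (z t))) = vecMulVec (z t) (star (z t)) := by
      rw [star_eq_conjTranspose, conjTranspose_vecMulVec, star_star]
    rw [IsSelfAdjoint, hW]
    simp only [star_sub, star_smul, star_one, h1, h2]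
  have hWz (t : ℝ) : W t *ᵥ z t = 0 := by
    simp only [hW, sub_mulVec, smul_mulVec, one_mulVec, vecMulVec_mulVec]
    simp
  refine ⟨fun t => algebraMap ℝ _ r + W t * T * W t, ?_, ?_, fun t => ?_, fun t => ?_⟩
  · have hWc : Continuous W := by
      refine Continuous.sub ?_ (hzc.matrix_vecMulVec hzc.star)
      exact (hzc.star.dotProduct hzc).smul continuous_const
    fun_prop
  · have h0 : W 0 = 1 - vecMulVec v (star v) := by simp [hW, hz, hv1]
    have e1 : vecMulVec v (star v) * T = 0 := by rw [vecMulVec_mul, hvT, vecMulVec_zero]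
    have e2 : T * vecMulVec v (star v) = 0 := by rw [mul_vecMulVec, hTv, zero_vecMulVec]
    simp only [h0, sub_mul, one_mul, e1, sub_zero, mul_sub, mul_one, e2]
    simp [hT]
  · refine (IsSelfAdjoint.algebraMap _ (.all r)).add ?_
    have := hTsa.conjugate (W t)
    rwa [(hWsa t).star_eq] at this
  · change _ *ᵥ z t = _ • z t
    rw [add_mulVec, algebraMap_real_mulVec, ← mulVec_mulVec, hWz, mulVec_zero, add_zero]

end HermitianMatrix

section Ray

open Matrix
open scoped ComplexOrder

variable {m : ℕ}

theorem Ray.state_eq_dotProduct (v : EuclideanSpace ℂ (Fin m)) (a : Matrix (Fin m) (Fin m) ℂ) :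
    inner ℂ v (Matrix.toEuclideanLin a v) = star v.ofLp ⬝ᵥ a *ᵥ v.ofLp := by
  rw [EuclideanSpace.inner_eq_star_dotProduct, dotProduct_comm]
  rfl

theorem Matrix.star_dotProduct_self_eq_one_iff (u : Fin m → ℂ) :
    star u ⬝ᵥ u = 1 ↔ ‖WithLp.toLp 2 u‖ = 1 := by
  have := inner_self_eq_norm_sq_to_K (𝕜 := ℂ) (WithLp.toLp 2 u)
  rw [EuclideanSpace.inner_eq_star_dotProduct, dotProduct_comm] at this
  change star u ⬝ᵥ u = _ at this
  rw [this, ← sq_eq_sq₀ (norm_nonneg _) zero_le_one, one_pow, ← Complex.ofReal_inj]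
  simp

theorem Ray.exists_unit_vector (ξ : Ray m) : ∃ u : Fin m → ℂ, star u ⬝ᵥ u = 1 ∧
    (∃ h, ξ = Projectivization.mk ℂ (WithLp.toLp 2 u) h) ∧
    ∀ a, ξ.state a = star u ⬝ᵥ a *ᵥ u := by
  have h0 : ‖ξ.rep‖ ≠ 0 := norm_ne_zero_iff.mpr ξ.rep_nonzero
  have h0' : (((‖ξ.rep‖⁻¹ : ℝ) : ℂ)) ≠ 0 := by exact_mod_cast inv_ne_zero h0
  refine ⟨((((‖ξ.rep‖⁻¹ : ℝ) : ℂ)) • ξ.rep).ofLp, ?_, ?_, fun a => ?_⟩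
  · rw [star_dotProduct_self_eq_one_iff, WithLp.toLp_ofLp, norm_smul, Complex.norm_real,
      norm_inv, norm_norm, inv_mul_cancel₀ h0]
  · refine ⟨smul_ne_zero h0' ξ.rep_nonzero, ?_⟩
    conv_lhs => rw [← ξ.mk_rep]
    rw [Projectivization.mk_eq_mk_iff']
    refine ⟨(((‖ξ.rep‖⁻¹ : ℝ) : ℂ))⁻¹, ?_⟩
    rw [WithLp.toLp_ofLp, smul_smul, inv_mul_cancel₀ h0', one_smul]
  · rw [← Ray.state_eq_dotProduct]
    rfl

theorem Ray.exists_state_eq {u : Fin m → ℂ} (hu : star u ⬝ᵥ u = 1) :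
    ∃ ξ : Ray m, ∀ a, ξ.state a = star u ⬝ᵥ a *ᵥ u := by
  have h1 := (star_dotProduct_self_eq_one_iff u).mp hu
  have h0 : WithLp.toLp 2 u ≠ 0 := by
    rw [← norm_ne_zero_iff, h1]; exact one_ne_zero
  exact ⟨Projectivization.mk ℂ _ h0, fun a => by
    rw [Ray.state_mk _ h0 h1, Ray.state_eq_dotProduct]⟩

theorem Ray.continuous_state (ξ : Ray m) : Continuous ξ.state :=
  ξ.state.continuous_of_finiteDimensional

theorem Ray.nonempty (hm : 1 ≤ m) : Nonempty (Ray m) := by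
  obtain ⟨ξ, -⟩ := Ray.exists_state_eq (u := Pi.single (⟨0, hm⟩ : Fin m) 1) (by simp)
  exact ⟨ξ⟩

theorem Ray.exists_ne (hm : 2 ≤ m) : ∃ ξ η : Ray m, ξ ≠ η := by
  have hne : (⟨0, by lia⟩ : Fin m) ≠ ⟨1, hm⟩ := by simp
  set i : Fin m := ⟨0, by lia⟩
  set j : Fin m := ⟨1, hm⟩
  obtain ⟨ξ, hξ⟩ := Ray.exists_state_eq (u := Pi.single i 1) (by simp)
  obtain ⟨η, hη⟩ := Ray.exists_state_eq (u := Pi.single j 1) (by simp)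
  refine ⟨ξ, η, fun h => ?_⟩
  have h₁ := hξ (diagonal (Pi.single i 1))
  have h₂ := hη (diagonal (Pi.single i 1))
  rw [h, h₂] at h₁
  simp [mulVec_single, hne.symm] at h₁

/-- Rays are separated by hermitian matrices: the projection onto one of two distinct lines
distinguishes them. -/
theorem Ray.eq_of_re_state_eq {ξ η : Ray m}
    (h : ∀ a : Matrix (Fin m) (Fin m) ℂ, IsSelfAdjoint a → (ξ.state a).re = (η.state a).re) :
    ξ = η := by
  obtain ⟨u, hu, ⟨hu0, rfl⟩, hξ⟩ := ξ.exists_unit_vector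
  obtain ⟨w, hw, ⟨hw0, rfl⟩, hη⟩ := η.exists_unit_vector
  have hp := h (vecMulVec u (star u)) (by
    rw [IsSelfAdjoint, star_eq_conjTranspose, conjTranspose_vecMulVec, star_star])
  set c : ℂ := star u ⬝ᵥ w with hc
  have hc' : star w ⬝ᵥ u = star c := by rw [hc, star_dotProduct]
  rw [hξ, hη, vecMulVec_mulVec, vecMulVec_mulVec, hu, ← hc] at hp
  simp only [MulOpposite.op_one, one_smul, hu, op_smul_eq_smul, dotProduct_smul, hc',
    smul_eq_mul, Complex.star_def, Complex.mul_conj, Complex.one_re, Complex.ofReal_re] at hp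
  -- The component of `w` orthogonal to `u` has squared norm `1 - |⟨u, w⟩|² = 0`.
  have hz : w - c • u = 0 := by
    rw [← dotProduct_star_self_eq_zero]
    simp only [star_sub, star_smul]
    simp only [sub_dotProduct, dotProduct_sub, smul_dotProduct, dotProduct_smul, hu, hw, hc',
      ← hc, smul_eq_mul, mul_one, Complex.star_def]
    have : c * (starRingEnd ℂ) c = 1 := by rw [Complex.mul_conj, ← hp, Complex.ofReal_one]
    linear_combination -this
  symm
  rw [Projectivization.mk_eq_mk_iff']
  exact ⟨c, by rw [← WithLp.toLp_smul, ← sub_eq_zero.mp hz]⟩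

/-- Spectral form of the comparison of all pure states of two matrix algebras. -/
theorem maxSpec_le_minSpec_iff {k : ℕ} (hm : 1 ≤ m) (hk : 1 ≤ k)
    {a : Matrix (Fin m) (Fin m) ℂ} {b : Matrix (Fin k) (Fin k) ℂ}
    (ha : IsSelfAdjoint a) (hb : IsSelfAdjoint b) :
    maxSpec a ≤ minSpec b ↔
      ∀ (ξ : Ray m) (η : Ray k), (ξ.state a).re ≤ (η.state b).re := by
  constructor
  · intro h ξ η
    obtain ⟨u, hu, -, hξ⟩ := ξ.exists_unit_vector
    obtain ⟨w, hw, -, hη⟩ := η.exists_unit_vector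
    rw [hξ, hη]
    exact (re_dotProduct_mulVec_le_maxSpec ha hu).trans
      (h.trans (minSpec_le_re_dotProduct_mulVec hb hw))
  · intro h
    obtain ⟨u, hu, hau⟩ := exists_unit_eigenvector (maxSpec_mem hm ha)
    obtain ⟨w, hw, hbw⟩ := exists_unit_eigenvector (minSpec_mem hk hb)
    obtain ⟨ξ, hξ⟩ := Ray.exists_state_eq hu
    obtain ⟨η, hη⟩ := Ray.exists_state_eq hw
    have := h ξ η
    rwa [hξ, hη, hau, hbw, dotProduct_smul, dotProduct_smul, hu, hw, smul_eq_mul, smul_eq_mul,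
      mul_one, mul_one, Complex.ofReal_re, Complex.ofReal_re] at this

end Ray

/-! ### Isocones of a sum of two matrix algebras -/

section Core

open Matrix Filter Topology
open scoped MatrixOrder ComplexOrder

variable {m k : ℕ}

theorem Matrix.cfc_nonneg_posSemidef {a : Matrix (Fin m) (Fin m) ℂ} {f : ℝ → ℝ}
    (hf : ∀ s, 0 ≤ f s) : (cfc f a).PosSemidef :=
  Matrix.nonneg_iff_posSemidef.mp (cfc_nonneg fun s _ => hf s)

/-- The truncated ramp `s ↦ min 1 (max 0 ((s - p) / (q - p)))`, which rises from `0` at `p` to `1`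
at `q`. -/
noncomputable def ramp (p q : ℝ) (s : ℝ) : ℝ := min 1 (max 0 ((s - p) / (q - p)))

theorem continuous_ramp (p q : ℝ) : Continuous (ramp p q) := by
  unfold ramp
  fun_prop

theorem monotone_ramp {p q : ℝ} (h : p < q) : Monotone (ramp p q) := by
  intro s t hst
  have : 0 ≤ q - p := by linarith
  unfold ramp
  gcongr

theorem ramp_nonneg (p q s : ℝ) : 0 ≤ ramp p q s := le_min zero_le_one (le_max_left _ _)

theorem ramp_le_one (p q s : ℝ) : ramp p q s ≤ 1 := min_le_left _ _

theorem ramp_eq_zero {p q s : ℝ} (h : p < q) (hs : s ≤ p) : ramp p q s = 0 := by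
  have : (s - p) / (q - p) ≤ 0 := div_nonpos_of_nonpos_of_nonneg (by linarith) (by linarith)
  simp [ramp, max_eq_left this]

theorem ramp_eq_one {p q s : ℝ} (h : p < q) (hs : q ≤ s) : ramp p q s = 1 := by
  have : 1 ≤ (s - p) / (q - p) := by rw [le_div_iff₀ (by linarith)]; linarith
  rw [ramp, max_eq_right (by linarith), min_eq_left this]

/-- For positive semidefinite `P` and `P'`, a ramp that reaches `1` below the positive eigenvalues of
`P + P'` gives the projection onto the range of `P + P'`, which contains the ranges of `P` and
`P'`. -/
theorem Matrix.exists_ramp_fix {P P' : Matrix (Fin m) (Fin m) ℂ} (hP : P.PosSemidef)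
    (hP' : P'.PosSemidef) :
    ∃ q : ℝ, 0 < q ∧ ∀ v : Fin m → ℂ,
      cfc (ramp 0 q) (P + P') *ᵥ (P *ᵥ v) = P *ᵥ v ∧
      cfc (ramp 0 q) (P + P') *ᵥ (P' *ᵥ v) = P' *ᵥ v := by
  have hS : (P + P').PosSemidef := hP.add hP'
  set S := P + P' with hSdef
  have hSsa : IsSelfAdjoint S := hS.isHermitian
  have hspec : ∀ s ∈ spectrum ℝ S, 0 ≤ s :=
    fun s hs => spectrum_nonneg_of_nonneg (Matrix.nonneg_iff_posSemidef.mpr hS) hs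
  have hfin : (spectrum ℝ S).Finite := S.finite_real_spectrum
  obtain ⟨q, hq, hqs⟩ : ∃ q : ℝ, 0 < q ∧ ∀ s ∈ spectrum ℝ S, s = 0 ∨ q ≤ s := by
    have hcl : IsClosed (spectrum ℝ S \ {0}) := (hfin.subset Set.sdiff_subset).isClosed
    obtain ⟨q, hq, hball⟩ := Metric.isOpen_iff.mp hcl.isOpen_compl 0 (by simp)
    refine ⟨q, hq, fun s hs => or_iff_not_imp_left.mpr fun h0 => ?_⟩
    by_contra hlt
    refine hball (a := s) ?_ ⟨hs, h0⟩
    rw [Metric.mem_ball, Real.dist_eq, sub_zero, abs_of_nonneg (hspec s hs)]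
    exact not_le.mp hlt
  refine ⟨q, hq, ?_⟩
  -- `N` is the projection onto the kernel of `P + P'`.
  set N := 1 - cfc (ramp 0 q) S with hN
  have hNsa : IsSelfAdjoint N := (IsSelfAdjoint.one _).sub (cfc_predicate _ _)
  have hSN : S * N = 0 := by
    have e : S * cfc (ramp 0 q) S = S := by
      have hc := (continuous_ramp 0 q).continuousOn (s := spectrum ℝ S)
      have h1 := cfc_mul (fun s => s) (ramp 0 q) S (continuousOn_id' _) hc
      rw [cfc_id' ℝ S hSsa] at h1
      rw [← h1]
      refine (cfc_congr fun s hs => ?_).trans (cfc_id' ℝ S hSsa)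
      rcases hqs s hs with rfl | h
      · simp
      · simp [ramp_eq_one hq h]
    rw [hN, mul_sub, mul_one, e, sub_self]
  have key (v : Fin m → ℂ) : P *ᵥ (N *ᵥ v) = 0 ∧ P' *ᵥ (N *ᵥ v) = 0 := by
    have h0 : S *ᵥ (N *ᵥ v) = 0 := by rw [mulVec_mulVec, hSN, zero_mulVec]
    have h1 : star (N *ᵥ v) ⬝ᵥ P *ᵥ (N *ᵥ v) + star (N *ᵥ v) ⬝ᵥ P' *ᵥ (N *ᵥ v) = 0 := by
      rw [← dotProduct_add, ← add_mulVec, h0, dotProduct_zero]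
    have h2 := hP.dotProduct_mulVec_nonneg (N *ᵥ v)
    have h3 := hP'.dotProduct_mulVec_nonneg (N *ᵥ v)
    obtain ⟨h4, h5⟩ := (add_eq_zero_iff_of_nonneg h2 h3).mp h1
    exact ⟨(hP.dotProduct_mulVec_zero_iff _).mp h4, (hP'.dotProduct_mulVec_zero_iff _).mp h5⟩
  have key' {Q : Matrix (Fin m) (Fin m) ℂ} (hQ : Q.IsHermitian) (h : ∀ v, Q *ᵥ (N *ᵥ v) = 0)
      (v : Fin m → ℂ) : cfc (ramp 0 q) S *ᵥ (Q *ᵥ v) = Q *ᵥ v := by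
    have h1 : Q * N = 0 := by
      refine Matrix.ext_iff_mulVec.mpr fun v => ?_
      rw [← mulVec_mulVec, h, zero_mulVec]
    have h2 : N * Q = 0 := by
      have := congrArg star h1
      rwa [star_mul, star_zero, hNsa.star_eq, show star Q = Q from hQ] at this
    have h3 : N *ᵥ (Q *ᵥ v) = 0 := by rw [mulVec_mulVec, h2, zero_mulVec]
    rw [hN, sub_mulVec, one_mulVec, sub_eq_zero] at h3
    exact h3.symm
  exact fun v => ⟨key' hP.isHermitian (fun v => (key v).1) v,
    key' hP'.isHermitian (fun v => (key v).2) v⟩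

/-- Suppose the states of `ξ` and `η` are comparable on the isocone `J`, and `J` contains `(a, b)`
and `(a', b)`, where `a` and `a'` have an eigenvalue `r` larger than an eigenvalue `s` of `b`.
If the eigenvectors of `a` and `a'` generate `ξ`, then the eigenvector of `b` is orthogonal to
`η`. -/
theorem IsIsocone.dotProduct_eq_zero
    {J : Set (Matrix (Fin m) (Fin m) ℂ × Matrix (Fin k) (Fin k) ℂ)} (hJ : IsIsocone J)
    {x : Fin m → ℂ} {y : Fin k → ℂ} (hx : star x ⬝ᵥ x = 1) (hy : star y ⬝ᵥ y = 1)
    (hle : ∀ c ∈ J, (star x ⬝ᵥ c.1 *ᵥ x).re ≤ (star y ⬝ᵥ c.2 *ᵥ y).re)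
    {a a' : Matrix (Fin m) (Fin m) ℂ} {b : Matrix (Fin k) (Fin k) ℂ}
    (hab : (a, b) ∈ J) (hab' : (a', b) ∈ J) {r s : ℝ} (hsr : s < r)
    {v v' : Fin m → ℂ} {w : Fin k → ℂ} (hv : a *ᵥ v = (r : ℂ) • v)
    (hv' : a' *ᵥ v' = (r : ℂ) • v') (hw : b *ᵥ w = (s : ℂ) • w)
    {t : ℂ} (ht : t ≠ 0) (hvx : v' = v + t • x) :
    star w ⬝ᵥ y = 0 := by
  have hasa : IsSelfAdjoint a := congrArg Prod.fst (hJ.isSelfAdjoint _ hab)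
  have hasa' : IsSelfAdjoint a' := congrArg Prod.fst (hJ.isSelfAdjoint _ hab')
  have hbsa : IsSelfAdjoint b := congrArg Prod.snd (hJ.isSelfAdjoint _ hab)
  have mem {c : Matrix (Fin m) (Fin m) ℂ} {d : Matrix (Fin k) (Fin k) ℂ} (h : (c, d) ∈ J)
      {p q : ℝ} (hpq : p < q) : (cfc (ramp p q) c, cfc (ramp p q) d) ∈ J :=
    hJ.cfc_prodMk_mem h (continuous_ramp p q) (monotone_ramp hpq)
  set P := cfc (ramp s r) a with hPdef
  set P' := cfc (ramp s r) a' with hPdef'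
  set Q := cfc (ramp s r) b with hQdef
  have hP : P.PosSemidef := cfc_nonneg_posSemidef (ramp_nonneg s r)
  have hP' : P'.PosSemidef := cfc_nonneg_posSemidef (ramp_nonneg s r)
  have hQsa : IsSelfAdjoint Q := cfc_predicate _ _
  have hPv : P *ᵥ v = v := by simp [hPdef, cfc_mulVec hasa hv, ramp_eq_one hsr le_rfl]
  have hPv' : P' *ᵥ v' = v' := by simp [hPdef', cfc_mulVec hasa' hv', ramp_eq_one hsr le_rfl]
  have hQw : Q *ᵥ w = 0 := by simp [hQdef, cfc_mulVec hbsa hw, ramp_eq_zero hsr le_rfl]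
  obtain ⟨q, hq, hfix⟩ := exists_ramp_fix hP hP'
  have hJq := mem (hJ.add_mem _ (mem hab hsr) _ (mem hab' hsr)) hq
  have hcomp := hle _ hJq
  simp only [← hPdef, ← hPdef', ← hQdef] at hcomp
  have hxfix : cfc (ramp 0 q) (P + P') *ᵥ x = x := by
    have e1 := (hfix v).1
    have e2 := (hfix v').2
    rw [hPv] at e1
    rw [hPv', hvx, mulVec_add, e1, mulVec_smul, add_right_inj] at e2
    exact smul_right_injective _ ht e2
  set T := cfc (ramp 0 q) (Q + Q) with hT
  have hTsa : T.IsHermitian := (cfc_predicate (ramp 0 q) (Q + Q) : IsSelfAdjoint T)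
  have hTw : T *ᵥ w = 0 := by
    have h0 : (Q + Q) *ᵥ w = ((0 : ℝ) : ℂ) • w := by simp [add_mulVec, hQw]
    simp [hT, cfc_mulVec (hQsa.add hQsa) h0, ramp_eq_zero hq le_rfl]
  -- `T ≤ 1` has expectation at least `1` in the state of `y`, so that `T y = y`.
  have hTle : (1 - T).PosSemidef := by
    rw [← Matrix.le_iff]
    exact cfc_le_one _ _ fun s _ => ramp_le_one 0 q s
  have hTy : T *ᵥ y = y := by
    have h1 := hTle.dotProduct_mulVec_nonneg y
    have h2 : star y ⬝ᵥ (1 - T) *ᵥ y = 0 := by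
      refine le_antisymm ?_ h1
      refine Complex.le_def.mpr ⟨?_, (Complex.le_def.mp h1).2.symm⟩
      rw [hxfix, hx] at hcomp
      rw [sub_mulVec, one_mulVec, dotProduct_sub, hy, Complex.sub_re, Complex.zero_re]
      linarith
    rw [hTle.dotProduct_mulVec_zero_iff, sub_mulVec, one_mulVec, sub_eq_zero] at h2
    exact h2.symm
  rw [← hTy, Matrix.IsHermitian.dotProduct_mulVec_comm hTsa, hTw, star_zero, zero_dotProduct]

/-- If one pure state of the first block is below one pure state of the second block for an
isocone of a sum of two matrix algebras, then every pure state of the first block is below every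
pure state of the second. -/
theorem IsIsocone.state_le_of_state_le
    {J : Set (Matrix (Fin m) (Fin m) ℂ × Matrix (Fin k) (Fin k) ℂ)} (hJ : IsIsocone J)
    (hm : 1 ≤ m) (hk : 1 ≤ k) {ξ : Ray m} {η : Ray k}
    (hle : ∀ c ∈ J, (ξ.state c.1).re ≤ (η.state c.2).re) :
    ∀ c ∈ J, ∀ (ξ' : Ray m) (η' : Ray k), (ξ'.state c.1).re ≤ (η'.state c.2).re := by
  by_contra! hcon
  obtain ⟨c, hc, ξ', η', hlt⟩ := hcon
  obtain ⟨x, hx, -, hξ⟩ := ξ.exists_unit_vector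
  obtain ⟨y, hy, -, hη⟩ := η.exists_unit_vector
  replace hle : ∀ c ∈ J, (star x ⬝ᵥ c.1 *ᵥ x).re ≤ (star y ⬝ᵥ c.2 *ᵥ y).re :=
    fun c hc => by rw [← hξ, ← hη]; exact hle c hc
  have hU : IsOpen {c : Matrix (Fin m) (Fin m) ℂ × Matrix (Fin k) (Fin k) ℂ |
      (η'.state c.2).re < (ξ'.state c.1).re} :=
    isOpen_lt (Complex.continuous_re.comp (η'.continuous_state.comp continuous_snd))
      (Complex.continuous_re.comp (ξ'.continuous_state.comp continuous_fst))
  obtain ⟨⟨a, b⟩, hab, hlt, hnhds⟩ := hJ.exists_mem_nhdsWithin hU hc hlt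
  have hasa : IsSelfAdjoint a := congrArg Prod.fst (hJ.isSelfAdjoint _ hab)
  have hbsa : IsSelfAdjoint b := congrArg Prod.snd (hJ.isSelfAdjoint _ hab)
  have hsr : minSpec b < maxSpec a := by
    by_contra! h
    exact absurd ((maxSpec_le_minSpec_iff hm hk hasa hbsa).mp h ξ' η') (not_le.mpr hlt)
  obtain ⟨v, hv1, hv⟩ := exists_unit_eigenvector (maxSpec_mem hm hasa)
  obtain ⟨w, hw1, hw⟩ := exists_unit_eigenvector (minSpec_mem hk hbsa)
  obtain ⟨d, hdc, hd0, hdsa, hd⟩ := exists_perturbation hasa hv1 hv x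
  obtain ⟨e, hec, he0, hesa, he⟩ := exists_perturbation hbsa hw1 hw y
  have hev {f : ℝ → Matrix (Fin m) (Fin m) ℂ} {g : ℝ → Matrix (Fin k) (Fin k) ℂ}
      (hf : Continuous f) (hg : Continuous g) (hf0 : f 0 = a) (hg0 : g 0 = b)
      (hfsa : ∀ t, IsSelfAdjoint (f t)) (hgsa : ∀ t, IsSelfAdjoint (g t)) :
      ∀ᶠ t in 𝓝[≠] (0 : ℝ), (f t, g t) ∈ J := by
    have hcont : Tendsto (fun t => (f t, g t)) (𝓝[≠] 0) (𝓝 (a, b)) := by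
      have := (hf.prodMk hg).tendsto 0
      rw [hf0, hg0] at this
      exact this.mono_left nhdsWithin_le_nhds
    exact (tendsto_nhdsWithin_iff.mpr ⟨hcont, Eventually.of_forall fun t =>
      show star (f t, g t) = (f t, g t) from Prod.ext (hfsa t) (hgsa t)⟩).eventually hnhds
  obtain ⟨t, ⟨⟨h1, h2⟩, h3⟩, ht⟩ :=
    (((hev hdc continuous_const hd0 rfl hdsa fun _ => hbsa).and
      (hev continuous_const hec rfl he0 (fun _ => hasa) hesa)).and
      (hev hdc hec hd0 he0 hdsa hesa)).and self_mem_nhdsWithin |>.exists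
  have ht' : (t : ℂ) ≠ 0 := by exact_mod_cast ht
  have o1 := hJ.dotProduct_eq_zero hx hy hle hab h1 hsr hv (hd t) hw ht' rfl
  have o2 := hJ.dotProduct_eq_zero hx hy hle h2 h3 hsr hv (hd t) (he t) ht' rfl
  -- Both `w` and `w + t y` are orthogonal to the unit vector `y`, which is absurd.
  rw [star_add, add_dotProduct, o1, star_smul, smul_dotProduct, hy, zero_add, smul_eq_mul,
    mul_one, star_eq_zero] at o2
  exact ht' o2

end Core

/-! ### Isocones of almost commutative algebras -/

section AlmostCommutative

open Set Topology

variable {M : Type*} [TopologicalSpace M] {K : ℕ} {n : Fin K → ℕ}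

/-- Evaluation `F ↦ Fₖ(x)` at the point `(k, x)` of the base. -/
noncomputable def ACAlg.eval (p : Fin K × M) :
    ACAlg M n →⋆ₐ[ℂ] Matrix (Fin (n p.1)) (Fin (n p.1)) ℂ where
  toFun F := F p.2 p.1
  map_one' := rfl
  map_mul' _ _ := rfl
  map_zero' := rfl
  map_add' _ _ := rfl
  commutes' _ := rfl
  map_star' _ := rfl

theorem ACAlg.eval_apply (p : Fin K × M) (F : ACAlg M n) : ACAlg.eval p F = F p.2 p.1 := rfl

theorem ACAlg.continuous_eval (p : Fin K × M) : Continuous (ACAlg.eval (n := n) p) :=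
  (continuous_apply p.1).comp (continuous_eval_const p.2)

theorem ACAlg.isSelfAdjoint_apply {F : ACAlg M n} (hF : IsSelfAdjoint F) (k : Fin K) (x : M) :
    IsSelfAdjoint (F x k) :=
  hF.map (ACAlg.eval (k, x))

theorem ACPureState.continuous_state (p : ACPureState M n) : Continuous p.state :=
  p.2.2.continuous_state.comp (ACAlg.continuous_eval (p.1, p.2.1))

/-- The element of `⨁ₖ M_{nₖ}(ℂ)` with the single nonzero component `c` in the block `k`. -/
abbrev blockSingle (k : Fin K) (c : Matrix (Fin (n k)) (Fin (n k)) ℂ) :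
    (j : Fin K) → Matrix (Fin (n j)) (Fin (n j)) ℂ :=
  Pi.single k c

theorem star_blockSingle {k : Fin K} {c : Matrix (Fin (n k)) (Fin (n k)) ℂ}
    (hc : IsSelfAdjoint c) : star (blockSingle k c) = blockSingle k c := by
  rw [← Pi.single_star, hc.star_eq]

theorem ACAlg.exists_eval_eq (p : Fin K × M) {c : Matrix (Fin (n p.1)) (Fin (n p.1)) ℂ}
    (hc : IsSelfAdjoint c) : ∃ F : ACAlg M n, IsSelfAdjoint F ∧ ACAlg.eval p F = c := by
  refine ⟨ContinuousMap.const M (blockSingle p.1 c), ?_, ?_⟩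
  · ext1 x
    exact star_blockSingle hc
  · simp [ACAlg.eval_apply]

theorem localCone_eq_closure_image (I : Set (ACAlg M n)) (k : Fin K) (x : M) :
    localCone I k x = closure (ACAlg.eval (k, x) '' I) := by
  have : {a | ∃ F ∈ I, a = F x k} = ACAlg.eval (k, x) '' I :=
    Set.ext fun a => ⟨fun ⟨F, hF, h⟩ => ⟨F, hF, h.symm⟩, fun ⟨F, hF, h⟩ => ⟨F, hF, h.symm⟩⟩
  rw [localCone, this]

theorem functionalLE_localCone_iff (I : Set (ACAlg M n)) (k : Fin K) (x : M) (ξ η : Ray (n k)) :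
    FunctionalLE (localCone I k x) ξ.state η.state ↔
      FunctionalLE I (ACPureState.state ⟨k, x, ξ⟩) (ACPureState.state ⟨k, x, η⟩) := by
  refine ⟨fun h F hF => h _ (subset_closure ⟨F, hF, rfl⟩), fun h => ?_⟩
  refine FunctionalLE.closure ξ.continuous_state η.continuous_state ?_
  rintro _ ⟨F, hF, rfl⟩
  exact h F hF

/-- The point `p` of the base lies entirely below `q`: every pure state over `p` is `≤_I` every
pure state over `q`. -/
def FibreLE (I : Set (ACAlg M n)) (p q : Fin K × M) : Prop :=
  ∀ (ξ : Ray (n p.1)) (η : Ray (n q.1)),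
    FunctionalLE I (ACPureState.state ⟨p.1, p.2, ξ⟩) (ACPureState.state ⟨q.1, q.2, η⟩)

theorem isClosed_fibreLE (I : Set (ACAlg M n)) (k l : Fin K) :
    IsClosed {xy : M × M | FibreLE I (k, xy.1) (l, xy.2)} := by
  have : {xy : M × M | FibreLE I (k, xy.1) (l, xy.2)} =
      ⋂ (ξ : Ray (n k)) (η : Ray (n l)) (F ∈ I),
        {xy : M × M | (ξ.state (F xy.1 k)).re ≤ (η.state (F xy.2 l)).re} := by
    ext xy
    simp only [mem_iInter]
    rfl
  rw [this]
  refine isClosed_iInter fun ξ => isClosed_iInter fun η => isClosed_biInter fun F _ => ?_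
  have hF (j : Fin K) : Continuous fun x => F x j := (continuous_apply j).comp F.continuous
  exact isClosed_le
    (Complex.continuous_re.comp (ξ.continuous_state.comp ((hF k).comp continuous_fst)))
    (Complex.continuous_re.comp (η.continuous_state.comp ((hF l).comp continuous_snd)))

theorem isClosed_fibreLE_base (I : Set (ACAlg M n)) :
    IsClosed {pq : (Fin K × M) × (Fin K × M) | FibreLE I pq.1 pq.2} := by
  have : {pq : (Fin K × M) × (Fin K × M) | FibreLE I pq.1 pq.2} =
      ⋃ kl : Fin K × Fin K, {pq | (pq.1.1, pq.2.1) = kl} ∩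
        (fun pq : (Fin K × M) × (Fin K × M) => (pq.1.2, pq.2.2)) ⁻¹'
          {xy : M × M | FibreLE I (kl.1, xy.1) (kl.2, xy.2)} := by
    ext ⟨⟨k, x⟩, ⟨l, y⟩⟩
    simp
  rw [this]
  refine isClosed_iUnion_of_finite fun kl => IsClosed.inter ?_ ?_
  · exact isClosed_eq (by fun_prop) continuous_const
  · exact (isClosed_fibreLE I kl.1 kl.2).preimage (by fun_prop)

variable [CompactSpace M]

/-- The values of a self-adjoint element at two distinct points of the base can be prescribed:
distinct points of `M` are separated by Urysohn functions, distinct blocks by constants. -/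
theorem ACAlg.exists_eval_eq_and_eval_eq [T2Space M] {p q : Fin K × M} (hpq : p ≠ q)
    {c : Matrix (Fin (n p.1)) (Fin (n p.1)) ℂ} {d : Matrix (Fin (n q.1)) (Fin (n q.1)) ℂ}
    (hc : IsSelfAdjoint c) (hd : IsSelfAdjoint d) :
    ∃ F : ACAlg M n, IsSelfAdjoint F ∧ ACAlg.eval p F = c ∧ ACAlg.eval q F = d := by
  obtain ⟨k, x⟩ := p
  obtain ⟨l, y⟩ := q
  by_cases hkl : k = l
  · subst hkl
    have hxy : x ≠ y := fun h => hpq (by rw [h])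
    obtain ⟨g, hgx, hgy, -⟩ := exists_continuous_zero_one_of_isClosed
      (isClosed_singleton (x := x)) (isClosed_singleton (x := y))
      (disjoint_singleton.mpr hxy)
    have hgx' : g x = 0 := hgx rfl
    have hgy' : g y = 1 := hgy rfl
    refine ⟨⟨fun z => blockSingle k (((1 - g z : ℝ) : ℂ) • c + ((g z : ℝ) : ℂ) • d), ?_⟩,
      ?_, ?_, ?_⟩
    · exact (continuous_single k).comp (by fun_prop)
    · ext1 z
      refine star_blockSingle ?_
      rw [IsSelfAdjoint, star_add, star_smul, star_smul, hc.star_eq, hd.star_eq,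
        Complex.star_def, Complex.conj_ofReal, Complex.conj_ofReal]
    · simp [ACAlg.eval_apply, hgx']
    · simp [ACAlg.eval_apply, hgy']
  · refine ⟨ContinuousMap.const M (blockSingle k c + blockSingle l d), ?_, ?_, ?_⟩
    · ext1 x
      exact (star_add _ _).trans (congrArg₂ (· + ·) (star_blockSingle hc) (star_blockSingle hd))
    · simp [ACAlg.eval_apply, Pi.single_eq_of_ne hkl]
    · simp [ACAlg.eval_apply, Pi.single_eq_of_ne (Ne.symm hkl)]

theorem IsIsocone.localCone {I : Set (ACAlg M n)} (hI : IsIsocone I) (k : Fin K) (x : M) :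
    IsIsocone (localCone I k x) := by
  rw [localCone_eq_closure_image]
  exact hI.closure_image _ (ACAlg.continuous_eval _)
    fun _ hb => ACAlg.exists_eval_eq (k, x) hb

/-- Self-adjoint elements separate the pure states. -/
theorem ACPureState.eq_of_re_state_eq [T2Space M] {p q : ACPureState M n}
    (h : ∀ F : ACAlg M n, IsSelfAdjoint F → (p.state F).re = (q.state F).re) : p = q := by
  obtain ⟨k, x, ξ⟩ := p
  obtain ⟨l, y, η⟩ := q
  by_cases hpq : (k, x) = (l, y)
  · obtain ⟨rfl, rfl⟩ := Prod.mk.inj hpq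
    have : ξ = η := Ray.eq_of_re_state_eq fun a ha => by
      obtain ⟨F, hF, rfl⟩ := ACAlg.exists_eval_eq (M := M) (k, x) ha
      exact h F hF
    rw [this]
  · obtain ⟨F, hF, h₁, h₂⟩ := ACAlg.exists_eval_eq_and_eval_eq (n := n) hpq
      (IsSelfAdjoint.one _) (IsSelfAdjoint.zero _)
    have e := h F hF
    change (ξ.state (ACAlg.eval (k, x) F)).re = (η.state (ACAlg.eval (l, y) F)).re at e
    obtain ⟨u, hu, -, hξ⟩ := ξ.exists_unit_vector
    rw [h₁, h₂, map_zero, hξ, Matrix.one_mulVec, hu] at e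
    simp at e

theorem IsIsocone.isPartialOrder_state [T2Space M] {I : Set (ACAlg M n)} (hI : IsIsocone I) :
    IsPartialOrder (ACPureState M n) (fun p q => FunctionalLE I p.state q.state) where
  refl _ _ _ := le_rfl
  trans _ _ _ h₁ h₂ F hF := (h₁ F hF).trans (h₂ F hF)
  antisymm p q h₁ h₂ := ACPureState.eq_of_re_state_eq fun _ hF =>
    hI.re_eq_of_functionalLE p.continuous_state q.continuous_state h₁ h₂ hF

theorem fibreLE_iff_maxSpec_le_minSpec (hn : ∀ k, 1 ≤ n k) {I : Set (ACAlg M n)}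
    (hI : IsIsocone I) (k l : Fin K) (x y : M) :
    FibreLE I (k, x) (l, y) ↔ ∀ F ∈ I, maxSpec (F x k) ≤ minSpec (F y l) := by
  have key (F : ACAlg M n) (hF : F ∈ I) := maxSpec_le_minSpec_iff (hn k) (hn l)
    (ACAlg.isSelfAdjoint_apply (hI.isSelfAdjoint F hF) k x)
    (ACAlg.isSelfAdjoint_apply (hI.isSelfAdjoint F hF) l y)
  exact ⟨fun h F hF => (key F hF).mpr fun ξ η => h ξ η F hF,
    fun h ξ η F hF => (key F hF).mp (h F hF) ξ η⟩

/-- Over distinct points of the base, comparability of a single pair of pure states forces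
comparability of all pairs. -/
theorem fibreLE_of_functionalLE [T2Space M] (hn : ∀ k, 1 ≤ n k) {I : Set (ACAlg M n)}
    (hI : IsIsocone I) {p q : Fin K × M} (hpq : p ≠ q) {ξ : Ray (n p.1)} {η : Ray (n q.1)}
    (h : FunctionalLE I (ACPureState.state ⟨p.1, p.2, ξ⟩) (ACPureState.state ⟨q.1, q.2, η⟩)) :
    FibreLE I p q := by
  have hJ : IsIsocone (closure ((ACAlg.eval p).prod (ACAlg.eval q) '' I)) := by
    refine hI.closure_image _ ((ACAlg.continuous_eval p).prodMk (ACAlg.continuous_eval q)) ?_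
    rintro ⟨c, d⟩ hcd
    obtain ⟨F, hF, h₁, h₂⟩ := ACAlg.exists_eval_eq_and_eval_eq hpq
      (congrArg Prod.fst hcd : star c = c) (congrArg Prod.snd hcd : star d = d)
    exact ⟨F, hF, Prod.ext h₁ h₂⟩
  have hcl : IsClosed {c : Matrix (Fin (n p.1)) (Fin (n p.1)) ℂ ×
      Matrix (Fin (n q.1)) (Fin (n q.1)) ℂ | (ξ.state c.1).re ≤ (η.state c.2).re} :=
    isClosed_le (Complex.continuous_re.comp (ξ.continuous_state.comp continuous_fst))
      (Complex.continuous_re.comp (η.continuous_state.comp continuous_snd))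
  have hle := hJ.state_le_of_state_le (hn p.1) (hn q.1) (ξ := ξ) (η := η) fun c hc => by
    refine closure_minimal ?_ hcl hc
    rintro _ ⟨F, hF, rfl⟩
    exact h F hF
  exact fun ξ' η' F hF => hle _ (subset_closure ⟨F, hF, rfl⟩) ξ' η'

/-- A block of size at least two has distinct pure states, so that no point over it lies entirely
below itself. -/
theorem ne_of_fibreLE [T2Space M] (hn : ∀ k, 1 ≤ n k) {I : Set (ACAlg M n)} (hI : IsIsocone I)
    {k l : Fin K} {x y : M} (hkl : (n k, n l) ≠ (1, 1)) (h : FibreLE I (k, x) (l, y)) :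
    (k, x) ≠ (l, y) := by
  intro he
  obtain ⟨rfl, rfl⟩ := Prod.mk.inj he
  have hk : 2 ≤ n k := by
    have := hn k
    have : n k ≠ 1 := fun h1 => hkl (by rw [h1])
    lia
  obtain ⟨ξ, η, hne⟩ := Ray.exists_ne hk
  refine hne ?_
  have := (hI.isPartialOrder_state).antisymm _ _ (h ξ η) (h η ξ)
  simpa using this

end AlmostCommutative

theorem mainTheorem4 {M : Type*} [TopologicalSpace M] [CompactSpace M] [T2Space M]
    {K : ℕ} (n : Fin K → ℕ) (hn : ∀ k, 1 ≤ n k)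
    (I : Set (ACAlg M n)) (hI : IsIsocone I) :
    (∀ (k : Fin K) (x : M), IsIsocone (localCone I k x)) ∧
    IsPartialOrder (ACPureState M n) (fun p q => FunctionalLE I p.state q.state) ∧
    ∃ le : Fin K × M → Fin K × M → Prop,
      IsPartialOrder (Fin K × M) le ∧
      IsClosed {pq : (Fin K × M) × (Fin K × M) | le pq.1 pq.2} ∧
      (∀ p q : ACPureState M n, FunctionalLE I p.state q.state ↔
        LexRel (StrictPart le)
          (fun k x ξ η => FunctionalLE (localCone I k x) ξ.state η.state) p q) ∧
      (∀ k l : Fin K, (n k, n l) ≠ (1, 1) →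
        (∀ x y : M, StrictPart le (k, x) (l, y) ↔
          ∀ F ∈ I, maxSpec (F x k) ≤ minSpec (F y l)) ∧
        IsClosed {xy : M × M | StrictPart le (k, xy.1) (l, xy.2)}) := by
  have hstrict (p q : Fin K × M) :
      StrictPart (fun p q => p = q ∨ FibreLE I p q) p q ↔ FibreLE I p q ∧ p ≠ q :=
    ⟨fun h => ⟨h.1.resolve_left h.2, h.2⟩, fun h => ⟨Or.inr h.1, h.2⟩⟩
  have hstrict' (k l : Fin K) (hkl : (n k, n l) ≠ (1, 1)) (x y : M) :
      StrictPart (fun p q => p = q ∨ FibreLE I p q) (k, x) (l, y) ↔ FibreLE I (k, x) (l, y) :=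
    (hstrict _ _).trans ⟨And.left, fun h => ⟨h, ne_of_fibreLE hn hI hkl h⟩⟩
  have hpo := hI.isPartialOrder_state
  refine ⟨hI.localCone, hpo, fun p q => p = q ∨ FibreLE I p q,
    { refl := fun _ => Or.inl rfl, trans := ?_, antisymm := ?_ }, ?_, ?_, fun k l hkl =>
      ⟨fun x y => (hstrict' k l hkl x y).trans (fibreLE_iff_maxSpec_le_minSpec hn hI k l x y), ?_⟩⟩
  · rintro p q r (rfl | h₁) (rfl | h₂)
    · exact Or.inl rfl
    · exact Or.inr h₂
    · exact Or.inr h₁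
    · obtain ⟨ζ⟩ := Ray.nonempty (hn q.1)
      exact Or.inr fun ξ η => hpo.trans _ _ _ (h₁ ξ ζ) (h₂ ζ η)
  · rintro p q (h | h₁) (h' | h₂)
    · exact h
    · exact h
    · exact h'.symm
    · obtain ⟨ξ⟩ := Ray.nonempty (hn p.1)
      obtain ⟨η⟩ := Ray.nonempty (hn q.1)
      have := hpo.antisymm _ _ (h₁ ξ η) (h₂ η ξ)
      exact congrArg (fun s : ACPureState M n => (s.1, s.2.1)) this
  · exact isClosed_diagonal.union (isClosed_fibreLE_base I)
  · rintro ⟨k, x, ξ⟩ ⟨l, y, η⟩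
    constructor
    · intro h
      by_cases hpq : (k, x) = (l, y)
      · obtain ⟨rfl, rfl⟩ := Prod.mk.inj hpq
        exact .fibre ((functionalLE_localCone_iff I k x ξ η).mpr h)
      · exact .base ((hstrict _ _).mpr ⟨fibreLE_of_functionalLE hn hI hpq h, hpq⟩)
    · intro h
      cases h with
      | base h => exact ((hstrict _ _).mp h).1 ξ η
      | fibre h => exact (functionalLE_localCone_iff I _ _ _ _).mp h
  · simp only [hstrict' k l hkl]
    exact isClosed_fibreLE I k l
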